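/- Let $k,n,w,p,q\ge 0$ be integers. An ideal cipher is a family $\mathbf E=(\mathbf E_K)_{K\in\{0,1\}^k}$ of permutations of $\{0,1\}^n$, and $\mathsf{Ics}(k,n)$ is the set of all such families. For $K_1\in\{0,1\}^k$ and $K_2\in\{0,1\}^n$ the construction $\mathsf{FX}$ is $$\mathsf{FX}[\mathbf E](K_1\,\|\,K_2,x)=\mathbf E_{K_1}(x\oplus K_2)\oplus K_2,\qquad \mathsf{FX}[\mathbf E]^{-1}(K_1\,\|\,K_2,y)=\mathbf E_{K_1}^{-1}(y\oplus K_2)\oplus K_2 .$$ Consider a quantum adversary $\mathcal A$ with a memory of $w+k+2n$ qubits, initially all $0$. It may apply arbitrary unitaries to the memory and measure it in the computational basis at any time, with no bound on its running time; every step may depend on all earlier measurement outcomes and classical answers, and in the end it outputs a bit. It may make quantum queries to $\mathbf E$ and $\mathbf E^{-1}$, that is, apply the unitaries $|K,x,z\rangle\mapsto|K,x,\mathbf E_K(x)\oplus z\rangle$ and $|K,y,z\rangle\mapsto|K,y,\mathbf E_K^{-1}(y)\oplus z\rangle$ to its memory, and classical queries to two oracles $\mathsf{Ev},\mathsf{Inv}:\{0,1\}^n\to\{0,1\}^n$.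 Choose $\mathbf E\in\mathsf{Ics}(k,n)$, a key $K\in\{0,1\}^{k+n}$ and a permutation $P$ of $\{0,1\}^n$ uniformly and independently. In the real world, $\mathsf{Ev}=\mathsf{FX}[\mathbf E](K,\cdot)$ and $\mathsf{Inv}=\mathsf{FX}[\mathbf E]^{-1}(K,\cdot)$. In the ideal world, $\mathsf{Ev}=P$ and $\mathsf{Inv}=P^{-1}$. In both worlds the primitive queries are answered with the same $\mathbf E$. The SPRP advantage of $\mathcal A$ against $\mathsf{FX}$ is $$\mathsf{Adv}^{\mathsf{sprp}}_{\mathsf{FX}}(\mathcal A)=\Pr[\mathcal A\text{ outputs }1\text{ in the real world}]-\Pr[\mathcal A\text{ outputs }1\text{ in the ideal world}].$$ Suppose that $\mathcal A$ makes at most $p$ quantum queries to $\mathbf E$ and $\mathbf E^{-1}$ in total, and that its classical queries are non-adaptive and at most $q$ in number, in the following sense: there are strings $M_1,\dots,M_{q_1},Y_1,\dots,Y_{q_2}\in\{0,1\}^n$ with $q_1+q_2\le q$, fixed before the execution, such that $\mathcal A$ only ever queries $\mathsf{Ev}$ on some of the $M_i$ and $\mathsf{Inv}$ on some of the $Y_i$.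 Then $$\mathsf{Adv}^{\mathsf{sprp}}_{\mathsf{FX}}(\mathcal A)\le\sqrt{\frac{8p^2q}{2^{k+n}}}.$$ -/

import Mathlib

noncomputable section

/-- The set `{0,1}^m` of bit strings of length `m`. Addition is bitwise, so `+` is XOR. -/
abbrev Bits (m : ℕ) : Type := Fin m → ZMod 2

/-- `Ics(k, n)`: families `E` of permutations `E K` of `{0,1}^n`, indexed by keys `K ∈ {0,1}^k`. -/
abbrev IdealCipher (k n : ℕ) : Type := Bits k → Equiv.Perm (Bits n)

/-- A blockcipher with key length `l` and block length `n` that is built from an ideal cipher in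
`Ics(k, n)`. -/
abbrev CipherConstruction (k n l : ℕ) : Type := IdealCipher k n → IdealCipher l n

theorem Bits.add_self {m : ℕ} (x : Bits m) : x + x = 0 := by
  funext i
  exact CharTwo.add_self_eq_zero (x i)

theorem Bits.add_add_cancel_self {m : ℕ} (x y : Bits m) : x + y + y = x := by
  rw [add_assoc, Bits.add_self, add_zero]

/-- First part `K₁` of a key `K = K₁ ‖ K₂` of length `k + n`. -/
def keyFst {k n : ℕ} (K : Bits (k + n)) : Bits k := fun i => K (Fin.castAdd n i)

/-- Second part `K₂` of a key `K = K₁ ‖ K₂` of length `k + n`. -/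
def keySnd {k n : ℕ} (K : Bits (k + n)) : Bits n := fun i => K (Fin.natAdd k i)

/-- `FX[E](K₁ ‖ K₂, x) = E_{K₁}(x ⊕ K₂) ⊕ K₂`, together with its inverse. -/
def FX (k n : ℕ) : CipherConstruction k n (k + n) := fun E K =>
  { toFun := fun x => E (keyFst K) (x + keySnd K) + keySnd K
    invFun := fun y => (E (keyFst K)).symm (y + keySnd K) + keySnd K
    left_inv := fun x => by simp [Bits.add_add_cancel_self]
    right_inv := fun y => by simp [Bits.add_add_cancel_self] }

/-- Computational basis of the memory of an adversary: a work register of `w` qubits, and the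
three registers `K`, `X`, `Y` (of `k`, `n` and `n` qubits) on which the oracles of the ideal
cipher act. -/
abbrev Registers (k n w : ℕ) : Type := Bits w × Bits k × Bits n × Bits n

/-- State space of the memory. States may be subnormalized: after a measurement, the squared norm
is the probability of the outcomes obtained so far. -/
abbrev QState (k n w : ℕ) : Type := EuclideanSpace ℂ (Registers k n w)

/-- For a keyed function `F`, the permutation `(K, X, Y) ↦ (K, X, F_K(X) ⊕ Y)` of basis states. -/
def oraclePerm {k n : ℕ} (w : ℕ) (F : Bits k → Bits n → Bits n) :
    Equiv.Perm (Registers k n w) where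
  toFun r := (r.1, r.2.1, r.2.2.1, F r.2.1 r.2.2.1 + r.2.2.2)
  invFun r := (r.1, r.2.1, r.2.2.1, F r.2.1 r.2.2.1 + r.2.2.2)
  left_inv := fun ⟨a, K, x, y⟩ => by
    simp [← add_assoc, Bits.add_self]
  right_inv := fun ⟨a, K, x, y⟩ => by
    simp [← add_assoc, Bits.add_self]

/-- The unitary `|a, K, X, Y⟩ ↦ |a, K, X, F_K(X) ⊕ Y⟩`. -/
def oracleUnitary {k n : ℕ} (w : ℕ) (F : Bits k → Bits n → Bits n) :
    QState k n w ≃ₗᵢ[ℂ] QState k n w :=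
  LinearIsometryEquiv.piLpCongrLeft 2 ℂ ℂ (oraclePerm w F)

/-- The (unnormalized) state after a measurement of the function `f` of the registers, in the
computational basis, with outcome `o`. -/
def collapse {k n w m : ℕ} (f : Registers k n w → Bits m) (o : Bits m) (ψ : QState k n w) :
    QState k n w :=
  WithLp.toLp 2 fun r => if f r = o then ψ r else 0

/-- Quantum adversaries with quantum access to `𝐄`, `𝐄⁻¹` and classical access to `Ev`, `Inv`.
An adversary is a possibly adaptive strategy: its next step may depend on all measurement
outcomes and all classical answers so far, and everything else is in its quantum memory. There is
no bound on the complexity of its operations.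

* `halt b`: stop with output `b`;
* `applyUnitary U A`: apply the unitary `U` to the memory, then continue as `A`;
* `measureFn f A`: measure `f` in the computational basis, with outcome `o`, then continue as `A o`;
* `queryE A`, `queryEInv A`: make a quantum query to `𝐄` or `𝐄⁻¹` on the registers `K`, `X`, `Y`,
  then continue as `A`;
* `queryEv x A`, `queryInv x A`: make a classical query `x` to `Ev` or `Inv`, with answer `y`,
  then continue as `A y`. -/
inductive Adversary (k n w : ℕ) : Type
  | halt (b : Bool) : Adversary k n w
  | applyUnitary (U : QState k n w ≃ₗᵢ[ℂ] QState k n w) (A : Adversary k n w) : Adversary k n w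
  | measureFn {m : ℕ} (f : Registers k n w → Bits m) (A : Bits m → Adversary k n w) :
      Adversary k n w
  | queryE (A : Adversary k n w) : Adversary k n w
  | queryEInv (A : Adversary k n w) : Adversary k n w
  | queryEv (x : Bits n) (A : Bits n → Adversary k n w) : Adversary k n w
  | queryInv (x : Bits n) (A : Bits n → Adversary k n w) : Adversary k n w

namespace Adversary

variable {k n w : ℕ}

/-- The largest number of quantum queries to `𝐄` and `𝐄⁻¹` in an execution. -/
def primitiveQueries : Adversary k n w → ℕ
  | halt _ => 0
  | applyUnitary _ A => A.primitiveQueries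
  | measureFn _ A => Finset.univ.sup fun o => (A o).primitiveQueries
  | queryE A => A.primitiveQueries + 1
  | queryEInv A => A.primitiveQueries + 1
  | queryEv _ A => Finset.univ.sup fun y => (A y).primitiveQueries
  | queryInv _ A => Finset.univ.sup fun y => (A y).primitiveQueries

/-- The adversary only ever queries `Ev` on elements of `S` and `Inv` on elements of `T`. -/
def OnlyQueries (S T : Set (Bits n)) : Adversary k n w → Prop
  | halt _ => True
  | applyUnitary _ A => A.OnlyQueries S T
  | measureFn _ A => ∀ o, (A o).OnlyQueries S T
  | queryE A => A.OnlyQueries S T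
  | queryEInv A => A.OnlyQueries S T
  | queryEv x A => x ∈ S ∧ ∀ y, (A y).OnlyQueries S T
  | queryInv x A => x ∈ T ∧ ∀ y, (A y).OnlyQueries S T

/-- The adversary makes at most `q` classical, non-adaptive queries to `Ev`, `Inv`: there are
`M₁, …, M_{q₁}` and `Y₁, …, Y_{q₂}` with `q₁ + q₂ ≤ q`, fixed before the execution, such that it
only ever queries `Ev` on some `Mᵢ` and `Inv` on some `Yᵢ`. -/
def NonAdaptive (A : Adversary k n w) (q : ℕ) : Prop :=
  ∃ (q₁ q₂ : ℕ) (M : Fin q₁ → Bits n) (Y : Fin q₂ → Bits n),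
    q₁ + q₂ ≤ q ∧ A.OnlyQueries (Set.range M) (Set.range Y)

/-- The weight with which the adversary outputs `1` when it starts in the memory state `ψ`, the
primitive is `E` and the construction oracles are `Ev = Q` and `Inv = Q⁻¹`. -/
def acceptWeight (E : IdealCipher k n) (Q : Equiv.Perm (Bits n)) :
    Adversary k n w → QState k n w → ℝ
  | halt b, ψ => if b then ‖ψ‖ ^ 2 else 0
  | applyUnitary U A, ψ => A.acceptWeight E Q (U ψ)
  | measureFn f A, ψ => ∑ o, (A o).acceptWeight E Q (collapse f o ψ)
  | queryE A, ψ => A.acceptWeight E Q (oracleUnitary w (fun K x => E K x) ψ)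
  | queryEInv A, ψ => A.acceptWeight E Q (oracleUnitary w (fun K y => (E K).symm y) ψ)
  | queryEv x A, ψ => (A (Q x)).acceptWeight E Q ψ
  | queryInv y A, ψ => (A (Q.symm y)).acceptWeight E Q ψ

/-- The probability that the adversary outputs `1` when all registers are initialized to `0`. -/
def acceptProb (A : Adversary k n w) (E : IdealCipher k n) (Q : Equiv.Perm (Bits n)) : ℝ :=
  A.acceptWeight E Q (EuclideanSpace.single 0 1)

end Adversary

/-- The probability that the SPRP game for the construction `C` returns true, in the real world
(`b = true`) or in the ideal world (`b = false`): the ideal cipher `E`, the key `K` and the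
permutation `P` are uniform and independent, and the construction oracles give access to
`C E K` in the real world and to `P` in the ideal world. -/
def sprpGame {k n l w : ℕ} (C : CipherConstruction k n l) (b : Bool) (A : Adversary k n w) : ℝ :=
  (∑ E : IdealCipher k n, ∑ K : Bits l, ∑ P : Equiv.Perm (Bits n),
      A.acceptProb E (if b then C E K else P)) /
    (Fintype.card (IdealCipher k n) * Fintype.card (Bits l) *
      Fintype.card (Equiv.Perm (Bits n)))

/-- The SPRP advantage of `A` against the construction `C`. -/
def sprpAdvantage {k n l w : ℕ} (C : CipherConstruction k n l) (A : Adversary k n w) : ℝ :=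
  sprpGame C true A - sprpGame C false A

end

/-!
The idea is to realise the real world on the probability space of the ideal world, by
reprogramming the ideal cipher at a few places that are hidden by the key.

Let `E`, `K = K₁ ‖ K₂` and `P` be as in the ideal world, and let `π` be `P` conjugated by the
translation by `K₂`. The classical queries concern the values of `P` at a set of at most `q` points
`N`, namely the `Mᵢ` and the `P⁻¹(Yᵢ)`. Replacing `E_{K₁}` by a permutation that takes the same
values as `π` on the points `N + K₂`, and otherwise differs from `E_{K₁}` only where `E_{K₁}` takes
one of these values, gives an ideal cipher `E'` (`reprogram`). It is uniform (`sum_sum_reprogram`), and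
`FX[E'](K, ·)` answers all classical queries as `P` does. So the real game is the game in which
the primitive is `E'` and the construction oracles are `P`, `P⁻¹`.

Thus only the replacement of `E` by `E'` in the quantum queries has to be bounded, and in the game
with `E` the adversary's view is independent of `K`. Given `E` and `P`, the permutations
`E_{K'}` and `E'_{K'}` differ at `x` only if `K₁ = K'` and `x` or `E_{K'}(x)` lies in the
translate by `K₂` of `N` or `P(N)`, respectively, which holds for at most `2q` keys `K`
(`card_reprogram_ne_le`). Replacing `E` by `E'` one query at a time, beginning with the last one,
keeps the state `ψ` before the replaced query independent of `K`. The replacement changes the state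
after this query by at most twice the norm of the part of `ψ` where the two ciphers differ, and the
Cauchy–Schwarz inequality over the keys bounds the sum of these changes by
`2 * √(2 ^ (k + n) * (2 * q)) * ‖ψ‖` (`sum_norm_oracleUnitary_sub_le`). The acceptance weight
changes by no more than the state does (`acceptWeight_sub_le_of_norm_eq`); here a factor of two is
saved by using that the acceptance and the rejection weights add up to a constant. Since the
squared norms of the branches of a measurement add up, all this is an induction over the adversary
(`sum_acceptWeight_sub_le`).
-/

open Finset

/-! ### Reprogramming a permutation -/

namespace Equiv.Perm

variable {α : Type*} [DecidableEq α]

/-- The permutation obtained from `e` by forcing its values at the points of the list to be those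
of `π`, one point after the other; each value is moved to its place by a transposition. -/
def patch (π : Perm α) : List α → Perm α → Perm α
  | [], e => e
  | x :: L, e => patch π L (swap (e x) (π x) * e)

theorem patch_apply_of_mem_or (π : Perm α) (L : List α) (e : Perm α) {a : α}
    (h : a ∈ L ∨ e a = π a) : patch π L e a = π a := by
  induction L generalizing e with
  | nil => simpa [patch] using h
  | cons x L ih =>
    apply ih
    by_cases hax : a = x
    · subst hax
      right
      simp
    · rcases h with h | h
      · left
        simpa [hax] using h
      · right
        rw [mul_apply, swap_apply_of_ne_of_ne (fun h' => hax (e.injective h')), h]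
        rw [h]
        exact fun h' => hax (π.injective h')

theorem patch_apply_of_mem (π : Perm α) {L : List α} (e : Perm α) {a : α} (h : a ∈ L) :
    patch π L e a = π a :=
  patch_apply_of_mem_or π L e (Or.inl h)

theorem patch_apply_of_notMem (π : Perm α) (L : List α) (e : Perm α) {a : α}
    (h : a ∉ L) (h' : ∀ x ∈ L, e a ≠ π x) : patch π L e a = e a := by
  induction L generalizing e with
  | nil => rfl
  | cons x L ih =>
    have hax : a ≠ x := fun h0 => h (by simp [h0])
    have hs : (swap (e x) (π x) * e) a = e a := by
      rw [mul_apply, swap_apply_of_ne_of_ne (fun h0 => hax (e.injective h0)) (h' x (by simp))]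
    rw [patch, ih _ (fun h0 => h (by simp [h0])), hs]
    intro z hz
    rw [hs]
    exact h' z (by simp [hz])

theorem patch_mul (π : Perm α) (L : List α) (e τ : Perm α) (h : ∀ x ∈ L, τ x = x) :
    patch π L (e * τ) = patch π L e * τ := by
  induction L generalizing e with
  | nil => rfl
  | cons x L ih =>
    rw [patch, patch, mul_apply, h x (by simp), ← mul_assoc]
    exact ih _ fun z hz => h z (by simp [hz])

variable [Fintype α]

/-- The number of permutations that fix all points of `L`. -/
def fixCount (L : List α) : ℕ := #{τ : Perm α | ∀ x ∈ L, τ x = x}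

theorem fixCount_ne_zero (L : List α) : fixCount L ≠ 0 :=
  card_ne_zero_of_mem (a := 1) (by simp)

theorem sum_filter_fix_mul (F : Perm α → ℝ) (L : List α) (π e : Perm α)
    (h : ∀ x ∈ L, e x = π x) :
    ∑ τ : Perm α with ∀ x ∈ L, τ x = x, F (e * τ) =
      ∑ σ : Perm α with ∀ x ∈ L, σ x = π x, F σ := by
  refine sum_equiv (Equiv.mulLeft e) (fun τ => ?_) fun _ _ => rfl
  simp only [mem_filter, mem_univ, true_and, Equiv.coe_mulLeft, mul_apply]
  refine forall₂_congr fun x hx => ?_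
  rw [← h x hx, e.injective.eq_iff]

theorem card_filter_agree (L : List α) (π : Perm α) :
    #{σ : Perm α | ∀ x ∈ L, σ x = π x} = fixCount L := by
  have h := sum_filter_fix_mul (fun _ => (1 : ℝ)) L π π fun _ _ => rfl
  simp only [sum_const, nsmul_eq_mul, mul_one] at h
  exact_mod_cast h.symm

/-- If `e` is uniform, then `patch π L e` is uniform among the permutations that agree with `π`
on `L`: both laws are invariant under the permutations that fix `L` pointwise, which act
transitively on these. -/
theorem fixCount_mul_sum_patch (F : Perm α → ℝ) (L : List α) (π : Perm α) :
    fixCount L * ∑ e, F (patch π L e) =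
      Fintype.card (Perm α) * ∑ σ : Perm α with ∀ x ∈ L, σ x = π x, F σ := by
  have h₁ : ∀ τ ∈ ({τ : Perm α | ∀ x ∈ L, τ x = x} : Finset _),
      ∑ e, F (patch π L e * τ) = ∑ e, F (patch π L e) := by
    intro τ hτ
    rw [mem_filter] at hτ
    refine Fintype.sum_equiv (Equiv.mulRight τ) _ _ fun e => ?_
    rw [Equiv.coe_mulRight, patch_mul π L e τ hτ.2]
  have h₂ := sum_congr rfl h₁
  rw [sum_const, nsmul_eq_mul, sum_comm] at h₂
  rw [fixCount, ← h₂]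
  simp_rw [fun e => sum_filter_fix_mul F L π (patch π L e) fun x hx => patch_apply_of_mem π e hx]
  simp

/-- If `e` and `π` are uniform and independent, then `e` patched by `π` is uniform. The patched
points `L π` may depend on `π`, as long as they are determined by the values of `π` there. -/
theorem sum_sum_patch (F : Perm α → ℝ) (L : Perm α → List α)
    (hL : ∀ π σ : Perm α, (∀ x ∈ L π, σ x = π x) → ∀ x, x ∈ L σ ↔ x ∈ L π) :
    ∑ π, ∑ e, F (patch π (L π) e) = Fintype.card (Perm α) * ∑ e, F e := by
  have hL' : ∀ π σ : Perm α, (∀ x ∈ L π, σ x = π x) ↔ ∀ x ∈ L σ, π x = σ x := fun π σ =>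
    ⟨fun h x hx => (h x ((hL π σ h x).1 hx)).symm,
      fun h x hx => (h x ((hL σ π h x).1 hx)).symm⟩
  have h₁ : ∀ π, ∑ e, F (patch π (L π) e) = Fintype.card (Perm α) *
      ∑ σ : Perm α, if ∀ x ∈ L σ, π x = σ x then (fixCount (L σ) : ℝ)⁻¹ * F σ else 0 := by
    intro π
    have h₀ : (fixCount (L π) : ℝ) ≠ 0 := by exact_mod_cast fixCount_ne_zero _
    have h₂ := fixCount_mul_sum_patch F (L π) π
    rw [← eq_inv_mul_iff_mul_eq₀ h₀, mul_left_comm, mul_sum _ _ (_⁻¹), sum_filter] at h₂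
    rw [h₂]
    congr 1
    refine sum_congr rfl fun σ _ => ?_
    by_cases h : ∀ x ∈ L π, σ x = π x
    · have hc : fixCount (L σ) = fixCount (L π) := by
        simp only [fixCount, hL π σ h]
      rw [if_pos h, if_pos ((hL' π σ).1 h), hc]
    · rw [if_neg h, if_neg (mt (hL' π σ).2 h)]
  simp_rw [h₁]
  rw [← mul_sum, sum_comm]
  congr 1
  refine sum_congr rfl fun σ _ => ?_
  have h₀ : (fixCount (L σ) : ℝ) ≠ 0 := by exact_mod_cast fixCount_ne_zero _
  rw [← sum_filter, sum_const, card_filter_agree, nsmul_eq_mul, mul_inv_cancel_left₀ h₀]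

end Equiv.Perm

/-! ### Reprogramming an ideal cipher -/

section Reprogram

variable {k n : ℕ}

theorem Bits.eq_add_iff {m : ℕ} (x y z : Bits m) : x = y + z ↔ z = y + x := by
  constructor <;> rintro rfl <;> rw [← add_assoc, Bits.add_self, zero_add]

/-- The permutation `x ↦ P(x ⊕ a) ⊕ a`. -/
def conjShift (a : Bits n) (P : Equiv.Perm (Bits n)) : Equiv.Perm (Bits n) where
  toFun x := P (x + a) + a
  invFun y := P.symm (y + a) + a
  left_inv x := by simp [Bits.add_add_cancel_self]
  right_inv y := by simp [Bits.add_add_cancel_self]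

theorem conjShift_apply (a : Bits n) (P : Equiv.Perm (Bits n)) (x : Bits n) :
    conjShift a P x = P (x + a) + a := rfl

theorem conjShift_symm_apply (a : Bits n) (P : Equiv.Perm (Bits n)) (y : Bits n) :
    (conjShift a P).symm y = P.symm (y + a) + a := rfl

theorem conjShift_conjShift (a : Bits n) (P : Equiv.Perm (Bits n)) :
    conjShift a (conjShift a P) = P := by
  ext1 x
  simp [conjShift_apply, Bits.add_add_cancel_self]

theorem FX_eq_conjShift (E : IdealCipher k n) (K : Bits (k + n)) :
    FX k n E K = conjShift (keySnd K) (E (keyFst K)) := rfl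

theorem keyFst_keySnd_injective :
    Function.Injective fun K : Bits (k + n) => (keyFst K, keySnd K) := by
  intro K K' h
  simp only [Prod.mk.injEq] at h
  funext i
  refine Fin.addCases (fun i => ?_) (fun i => ?_) i
  · exact congrFun h.1 i
  · exact congrFun h.2 i

/-- The points at which the values of `π` are determined by the queries `M` to `π` and `Y` to its
inverse, where all queries and all points are translated by `a`. -/
def queryPoints (M Y : List (Bits n)) (a : Bits n) (π : Equiv.Perm (Bits n)) : List (Bits n) :=
  M.map (· + a) ++ Y.map fun y => π.symm (y + a)

theorem length_queryPoints (M Y : List (Bits n)) (a : Bits n) (π : Equiv.Perm (Bits n)) :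
    (queryPoints M Y a π).length = M.length + Y.length := by
  simp [queryPoints]

theorem mem_queryPoints_of_agree (M Y : List (Bits n)) (a : Bits n) (π σ : Equiv.Perm (Bits n))
    (h : ∀ x ∈ queryPoints M Y a π, σ x = π x) (x : Bits n) :
    x ∈ queryPoints M Y a σ ↔ x ∈ queryPoints M Y a π := by
  have h' : ∀ y ∈ Y, σ.symm (y + a) = π.symm (y + a) := fun y hy => by
    rw [Equiv.symm_apply_eq, h _ (List.mem_append_right _ (List.mem_map_of_mem hy)),
      Equiv.apply_symm_apply]
  rw [queryPoints, queryPoints, List.map_congr_left h']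

/-- The ideal cipher `E`, reprogrammed so that `FX` with key `K` answers the queries `M` and the
inverse queries `Y` as `P` does. -/
def reprogram (M Y : List (Bits n)) (P : Equiv.Perm (Bits n)) (E : IdealCipher k n)
    (K : Bits (k + n)) : IdealCipher k n :=
  Function.update E (keyFst K) <| Equiv.Perm.patch (conjShift (keySnd K) P)
    (queryPoints M Y (keySnd K) (conjShift (keySnd K) P)) (E (keyFst K))

theorem FX_reprogram_apply {M : List (Bits n)} (Y : List (Bits n)) (P : Equiv.Perm (Bits n))
    (E : IdealCipher k n) (K : Bits (k + n)) {x : Bits n} (hx : x ∈ M) :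
    FX k n (reprogram M Y P E K) K x = P x := by
  rw [FX_eq_conjShift, conjShift_apply, reprogram, Function.update_self,
    Equiv.Perm.patch_apply_of_mem, conjShift_apply, Bits.add_add_cancel_self,
    Bits.add_add_cancel_self]
  exact List.mem_append_left _ (List.mem_map_of_mem hx)

theorem FX_reprogram_symm_apply (M : List (Bits n)) {Y : List (Bits n)} (P : Equiv.Perm (Bits n))
    (E : IdealCipher k n) (K : Bits (k + n)) {y : Bits n} (hy : y ∈ Y) :
    (FX k n (reprogram M Y P E K) K).symm y = P.symm y := by
  have h : (reprogram M Y P E K (keyFst K)).symm (y + keySnd K) =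
      (conjShift (keySnd K) P).symm (y + keySnd K) := by
    rw [reprogram, Function.update_self, Equiv.symm_apply_eq, Equiv.Perm.patch_apply_of_mem,
      Equiv.apply_symm_apply]
    exact List.mem_append_right _ (List.mem_map_of_mem hy)
  rw [FX_eq_conjShift, conjShift_symm_apply, h, conjShift_symm_apply, Bits.add_add_cancel_self,
    Bits.add_add_cancel_self]

theorem sum_sum_update {ι β : Type*} [Fintype ι] [DecidableEq ι] [Fintype β] (i : ι)
    (f : (ι → β) → ℝ) :
    ∑ E : ι → β, ∑ e : β, f (Function.update E i e) = Fintype.card β * ∑ E, f E := by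
  -- Exchanging `E i` and `e` is an involution of the set of pairs.
  have hinv : Function.Involutive fun z : (ι → β) × β => (Function.update z.1 i z.2, z.1 i) := by
    rintro ⟨E, e⟩
    simp
  rw [← Fintype.sum_prod_type' (f := fun E e => f (Function.update E i e)),
    Fintype.sum_equiv hinv.toPerm (fun z => f (Function.update z.1 i z.2)) (fun z => f z.1)
      fun _ => rfl, Fintype.sum_prod_type, mul_sum]
  simp

/-- The reprogrammed ideal cipher is uniform. -/
theorem sum_sum_reprogram (M Y : List (Bits n)) (K : Bits (k + n)) (f : IdealCipher k n → ℝ) :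
    ∑ E : IdealCipher k n, ∑ P : Equiv.Perm (Bits n), f (reprogram M Y P E K) =
      Fintype.card (Equiv.Perm (Bits n)) * ∑ E : IdealCipher k n, f E := by
  have h₀ : (Fintype.card (Equiv.Perm (Bits n)) : ℝ) ≠ 0 := by
    exact_mod_cast Fintype.card_ne_zero
  have h₁ : ∀ E : IdealCipher k n, ∀ e : Equiv.Perm (Bits n),
      ∑ P : Equiv.Perm (Bits n), f (reprogram M Y P (Function.update E (keyFst K) e) K) =
      ∑ π : Equiv.Perm (Bits n), f (Function.update E (keyFst K)
        (Equiv.Perm.patch π (queryPoints M Y (keySnd K) π) e)) := by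
    intro E e
    refine Fintype.sum_equiv
      (Function.Involutive.toPerm _ (conjShift_conjShift (keySnd K))) _ _ fun P => ?_
    rw [reprogram, Function.update_self, Function.update_idem]
    rfl
  refine mul_left_cancel₀ h₀ ?_
  rw [← sum_sum_update (keyFst K)]
  simp_rw [h₁]
  rw [← sum_sum_update (keyFst K), mul_sum]
  refine sum_congr rfl fun E _ => ?_
  rw [sum_comm, Equiv.Perm.sum_sum_patch (fun e => f (Function.update E (keyFst K) e)) _
    (mem_queryPoints_of_agree M Y (keySnd K))]

/-- For few keys a given point is affected by the reprogramming. -/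
theorem card_key_le (N : List (Bits n)) (P : Equiv.Perm (Bits n)) (κ : Bits k) (x y : Bits n) :
    #{K : Bits (k + n) | keyFst K = κ ∧ ∃ z ∈ N, x = z + keySnd K ∨ y = P z + keySnd K} ≤
      2 * N.length := by
  let S : List (Bits k × Bits n) := N.map (fun z => (κ, z + x)) ++ N.map fun z => (κ, P z + y)
  have hS : S.length = 2 * N.length := by simp [S, two_mul]
  rw [← hS]
  refine (card_le_card_of_injOn (t := S.toFinset) (fun K => (keyFst K, keySnd K)) ?_
    keyFst_keySnd_injective.injOn).trans S.toFinset_card_le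
  intro K hK
  simp only [coe_filter, mem_univ, true_and, Set.mem_ofPred_eq] at hK
  obtain ⟨rfl, z, hz, h⟩ := hK
  simp only [Bits.eq_add_iff] at h
  simp only [List.coe_toFinset, Set.mem_ofPred_eq, S, List.mem_append, List.mem_map,
    Prod.mk.injEq, true_and]
  exact h.imp (fun h => ⟨z, hz, h.symm⟩) fun h => ⟨z, hz, h.symm⟩

/-- The patched points are the translates by `a` of points that depend on `P` only, and so are the
values there. This is why the key hides them. -/
theorem exists_of_mem_queryPoints {M Y : List (Bits n)} {a : Bits n} {P : Equiv.Perm (Bits n)}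
    {x : Bits n} (hx : x ∈ queryPoints M Y a (conjShift a P)) :
    ∃ z ∈ queryPoints M Y 0 P, x = z + a ∧ conjShift a P x = P z + a := by
  simp only [queryPoints, List.mem_append, List.mem_map, conjShift_symm_apply,
    Bits.add_add_cancel_self] at hx
  refine ⟨x + a, ?_, (Bits.add_add_cancel_self x a).symm, rfl⟩
  simp only [queryPoints, List.mem_append, List.mem_map, add_zero]
  refine hx.imp ?_ ?_
  · rintro ⟨z, hz, rfl⟩
    exact ⟨z, hz, (Bits.add_add_cancel_self z a).symm⟩
  · rintro ⟨y, hy, rfl⟩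
    exact ⟨y, hy, (Bits.add_add_cancel_self _ a).symm⟩

theorem card_reprogram_ne_le (M Y : List (Bits n)) (P : Equiv.Perm (Bits n))
    (E : IdealCipher k n) (κ : Bits k) (x : Bits n) :
    #{K : Bits (k + n) | reprogram M Y P E K κ x ≠ E κ x} ≤ 2 * (M.length + Y.length) := by
  rw [← length_queryPoints M Y 0 P]
  refine (card_le_card ?_).trans (card_key_le (queryPoints M Y 0 P) P κ x (E κ x))
  intro K
  simp only [mem_filter, mem_univ, true_and]
  intro hK
  obtain rfl : keyFst K = κ := by
    by_contra h
    exact hK (by rw [reprogram, Function.update_of_ne (Ne.symm h)])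
  refine ⟨rfl, ?_⟩
  by_contra! h
  refine hK ?_
  rw [reprogram, Function.update_self, Equiv.Perm.patch_apply_of_notMem]
  · intro hx
    obtain ⟨z, hz, h', -⟩ := exists_of_mem_queryPoints hx
    exact (h z hz).1 h'
  · intro u hu h₀
    obtain ⟨z, hz, -, h'⟩ := exists_of_mem_queryPoints hu
    exact (h z hz).2 (h₀.trans h')

theorem card_reprogram_symm_ne_le (M Y : List (Bits n)) (P : Equiv.Perm (Bits n))
    (E : IdealCipher k n) (κ : Bits k) (y : Bits n) :
    #{K : Bits (k + n) | (reprogram M Y P E K κ).symm y ≠ (E κ).symm y} ≤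
      2 * (M.length + Y.length) := by
  refine (card_le_card ?_).trans (card_reprogram_ne_le M Y P E κ ((E κ).symm y))
  intro K
  simp only [mem_filter, mem_univ, true_and, Equiv.apply_symm_apply]
  refine mt fun h => ?_
  rw [Equiv.symm_apply_eq, h]

end Reprogram

/-! ### Quantum queries to two functions -/

section Oracle

variable {k n w : ℕ}

/-- The component of `ψ` in the span of the basis states in `S`. -/
def restrictTo (S : Set (Registers k n w)) [DecidablePred (· ∈ S)] (ψ : QState k n w) :
    QState k n w :=
  WithLp.toLp 2 fun r => if r ∈ S then ψ r else 0

theorem norm_restrictTo_sq (S : Set (Registers k n w)) [DecidablePred (· ∈ S)]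
    (ψ : QState k n w) : ‖restrictTo S ψ‖ ^ 2 = ∑ r, if r ∈ S then ‖ψ r‖ ^ 2 else 0 := by
  rw [EuclideanSpace.norm_sq_eq]
  refine sum_congr rfl fun r _ => ?_
  by_cases h : r ∈ S <;> simp [restrictTo, h]

theorem oracleUnitary_apply (F : Bits k → Bits n → Bits n) (ψ : QState k n w)
    (r : Registers k n w) :
    oracleUnitary w F ψ r = ψ (r.1, r.2.1, r.2.2.1, F r.2.1 r.2.2.1 + r.2.2.2) := rfl

theorem norm_oracleUnitary_sub_le (F G : Bits k → Bits n → Bits n) (ψ : QState k n w) :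
    ‖oracleUnitary w F ψ - oracleUnitary w G ψ‖ ≤
      2 * ‖restrictTo {r : Registers k n w | F r.2.1 r.2.2.1 ≠ G r.2.1 r.2.2.1} ψ‖ := by
  set φ := restrictTo {r : Registers k n w | F r.2.1 r.2.2.1 ≠ G r.2.1 r.2.2.1} ψ with hφ
  have h : oracleUnitary w F (ψ - φ) = oracleUnitary w G (ψ - φ) := by
    ext r
    rw [oracleUnitary_apply, oracleUnitary_apply]
    by_cases h : F r.2.1 r.2.2.1 = G r.2.1 r.2.2.1
    · rw [h]
    · simp [hφ, restrictTo, h]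
  have h' : oracleUnitary w F ψ - oracleUnitary w G ψ =
      oracleUnitary w F φ - oracleUnitary w G φ := by
    rw [map_sub, map_sub] at h
    rw [sub_eq_sub_iff_sub_eq_sub, h]
  rw [h']
  refine (norm_sub_le _ _).trans_eq ?_
  rw [LinearIsometryEquiv.norm_map, LinearIsometryEquiv.norm_map, two_mul]

/-- If each point is changed by at most `c` members of a family of functions, then on average
over the family a quantum query is changed only slightly. -/
theorem sum_norm_oracleUnitary_sub_le {ι : Type*} [Fintype ι]
    (F : ι → Bits k → Bits n → Bits n) (G : Bits k → Bits n → Bits n) (c : ℕ)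
    (hc : ∀ κ x, #{j | F j κ x ≠ G κ x} ≤ c) (ψ : QState k n w) :
    ∑ j, ‖oracleUnitary w (F j) ψ - oracleUnitary w G ψ‖ ≤
      2 * √(Fintype.card ι * c) * ‖ψ‖ := by
  let φ : ι → QState k n w := fun j =>
    restrictTo {r : Registers k n w | F j r.2.1 r.2.2.1 ≠ G r.2.1 r.2.2.1} ψ
  have hφ : ∑ j, ‖φ j‖ ^ 2 ≤ c * ‖ψ‖ ^ 2 := by
    simp only [φ, norm_restrictTo_sq]
    rw [sum_comm, EuclideanSpace.norm_sq_eq, mul_sum]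
    refine sum_le_sum fun r _ => ?_
    simp only [Set.mem_ofPred_eq]
    rw [← sum_filter, sum_const, nsmul_eq_mul]
    gcongr
    exact hc _ _
  have hsum : ∑ j, ‖φ j‖ ≤ √(Fintype.card ι * c) * ‖ψ‖ := by
    refine le_of_sq_le_sq ?_ (by positivity)
    rw [mul_pow, Real.sq_sqrt (by positivity), mul_assoc]
    refine (sq_sum_le_card_mul_sum_sq (s := univ) (f := fun j => ‖φ j‖)).trans ?_
    rw [card_univ]
    gcongr
  calc ∑ j, ‖oracleUnitary w (F j) ψ - oracleUnitary w G ψ‖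
      ≤ ∑ j, 2 * ‖φ j‖ := sum_le_sum fun j _ => norm_oracleUnitary_sub_le (F j) G ψ
    _ = 2 * ∑ j, ‖φ j‖ := (mul_sum _ _ _).symm
    _ ≤ 2 * (√(Fintype.card ι * c) * ‖ψ‖) := by gcongr
    _ = _ := (mul_assoc _ _ _).symm

theorem collapse_add {m : ℕ} (f : Registers k n w → Bits m) (o : Bits m) (φ ψ : QState k n w) :
    collapse f o (φ + ψ) = collapse f o φ + collapse f o ψ := by
  ext r
  by_cases h : f r = o <;> simp [collapse, h]

theorem collapse_sub {m : ℕ} (f : Registers k n w → Bits m) (o : Bits m) (φ ψ : QState k n w) :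
    collapse f o (φ - ψ) = collapse f o φ - collapse f o ψ := by
  ext r
  by_cases h : f r = o <;> simp [collapse, h]

theorem sum_norm_collapse_sq {m : ℕ} (f : Registers k n w → Bits m) (ψ : QState k n w) :
    ∑ o, ‖collapse f o ψ‖ ^ 2 = ‖ψ‖ ^ 2 := by
  simp only [EuclideanSpace.norm_sq_eq]
  rw [sum_comm]
  refine sum_congr rfl fun r _ => ?_
  rw [sum_eq_single (f r)] <;> simp +contextual [collapse, eq_comm]

end Oracle

/-! ### The acceptance weight -/

namespace Adversary

variable {k n w : ℕ}

theorem acceptWeight_congr (A : Adversary k n w) {S T : Set (Bits n)} (hA : A.OnlyQueries S T)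
    (E : IdealCipher k n) {Q Q' : Equiv.Perm (Bits n)} (hS : ∀ x ∈ S, Q x = Q' x)
    (hT : ∀ y ∈ T, Q.symm y = Q'.symm y) (ψ : QState k n w) :
    A.acceptWeight E Q ψ = A.acceptWeight E Q' ψ := by
  induction A generalizing ψ with
  | halt b => rfl
  | applyUnitary U A ih => exact ih hA _
  | measureFn f A ih => exact sum_congr rfl fun o _ => ih o (hA o) _
  | queryE A ih => exact ih hA _
  | queryEInv A ih => exact ih hA _
  | queryEv x A ih =>
    rw [acceptWeight, acceptWeight, hS x hA.1]
    exact ih _ (hA.2 _) _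
  | queryInv y A ih =>
    rw [acceptWeight, acceptWeight, hT y hA.1]
    exact ih _ (hA.2 _) _

/-- The acceptance weight is a quadratic form between `0` and `‖ψ‖ ^ 2`. Twice such a form, less
`‖ψ‖ ^ 2`, has operator norm at most one; this is the inequality that this gives, in a form that
is inherited by sums over the outcomes of a measurement. -/
theorem two_mul_acceptWeight_sub_le (A : Adversary k n w) (E : IdealCipher k n)
    (Q : Equiv.Perm (Bits n)) (φ ψ : QState k n w) :
    2 * (A.acceptWeight E Q φ - A.acceptWeight E Q ψ) ≤
      (‖φ‖ ^ 2 - ‖ψ‖ ^ 2) + ‖φ - ψ‖ * ‖φ + ψ‖ := by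
  have hU : ∀ (U : QState k n w ≃ₗᵢ[ℂ] QState k n w) (φ ψ : QState k n w),
      (‖U φ‖ ^ 2 - ‖U ψ‖ ^ 2) + ‖U φ - U ψ‖ * ‖U φ + U ψ‖ =
        (‖φ‖ ^ 2 - ‖ψ‖ ^ 2) + ‖φ - ψ‖ * ‖φ + ψ‖ := by
    intro U φ ψ
    simp only [← map_sub, ← map_add, LinearIsometryEquiv.norm_map]
  induction A generalizing φ ψ with
  | halt b =>
    have h : ∀ u v : QState k n w, ‖u‖ ^ 2 - ‖v‖ ^ 2 ≤ ‖u - v‖ * ‖u + v‖ := by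
      intro u v
      have h₁ : ‖u‖ ^ 2 - ‖v‖ ^ 2 = RCLike.re (inner ℂ (u - v) (u + v)) := by
        have := inner_re_symm (𝕜 := ℂ) u v
        simp only [inner_sub_left, inner_add_right, map_sub, map_add, inner_self_eq_norm_sq]
        linarith
      rw [h₁]
      exact re_inner_le_norm _ _
    cases b with
    | true =>
      simp only [acceptWeight, if_true]
      linarith [h φ ψ]
    | false =>
      have := h ψ φ
      rw [norm_sub_rev, add_comm ψ φ] at this
      simp only [acceptWeight, Bool.false_eq_true, if_false]
      linarith
  | applyUnitary U A ih => exact (ih _ _).trans_eq (hU _ _ _)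
  | measureFn f A ih =>
    rw [acceptWeight, acceptWeight, ← sum_sub_distrib, mul_sum]
    refine (sum_le_sum fun o _ => ih o _ _).trans ?_
    rw [sum_add_distrib, sum_sub_distrib, sum_norm_collapse_sq, sum_norm_collapse_sq]
    refine add_le_add_right ?_ _
    simp only [← collapse_sub, ← collapse_add]
    refine (Real.sum_mul_le_sqrt_mul_sqrt _ _ _).trans_eq ?_
    rw [sum_norm_collapse_sq, sum_norm_collapse_sq, Real.sqrt_sq (norm_nonneg _),
      Real.sqrt_sq (norm_nonneg _)]
  | queryE A ih => exact (ih _ _).trans_eq (hU _ _ _)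
  | queryEInv A ih => exact (ih _ _).trans_eq (hU _ _ _)
  | queryEv x A ih => exact ih _ _ _
  | queryInv y A ih => exact ih _ _ _

theorem acceptWeight_sub_le_of_norm_eq (A : Adversary k n w) (E : IdealCipher k n)
    (Q : Equiv.Perm (Bits n)) {φ ψ : QState k n w} {a : ℝ} (hφ : ‖φ‖ = a) (hψ : ‖ψ‖ = a) :
    A.acceptWeight E Q φ - A.acceptWeight E Q ψ ≤ ‖φ - ψ‖ * a := by
  have h₁ := A.two_mul_acceptWeight_sub_le E Q φ ψ
  have h₂ := mul_le_mul_of_nonneg_left (norm_add_le φ ψ) (norm_nonneg (φ - ψ))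
  rw [hφ, hψ] at h₁ h₂
  linarith

/-- Replacing an ideal cipher `E` by a member of a family of ideal ciphers, in which each value and
each inverse value of `E` is changed by at most `c` members, changes the acceptance weight only
slightly on average. -/
theorem sum_acceptWeight_sub_le {ι : Type*} [Fintype ι] (A : Adversary k n w)
    (F : ι → IdealCipher k n) (E : IdealCipher k n) (Q : Equiv.Perm (Bits n)) (c : ℕ)
    (hc : ∀ κ x, #{j | F j κ x ≠ E κ x} ≤ c)
    (hc' : ∀ κ y, #{j | (F j κ).symm y ≠ (E κ).symm y} ≤ c) (ψ : QState k n w) :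
    ∑ j, (A.acceptWeight (F j) Q ψ - A.acceptWeight E Q ψ) ≤
      A.primitiveQueries * (2 * √(Fintype.card ι * c)) * ‖ψ‖ ^ 2 := by
  -- One query, given the bound for the remaining ones: first the state after the query is
  -- replaced by the one for `E`, then the ideal cipher in the remaining execution.
  have hstep : ∀ (B : Adversary k n w) (G : ι → Bits k → Bits n → Bits n)
      (G₀ : Bits k → Bits n → Bits n) (_ : ∀ κ x, #{j | G j κ x ≠ G₀ κ x} ≤ c)
      (ψ : QState k n w)
      (_ : ∑ j, (B.acceptWeight (F j) Q (oracleUnitary w G₀ ψ) -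
        B.acceptWeight E Q (oracleUnitary w G₀ ψ)) ≤
        B.primitiveQueries * (2 * √(Fintype.card ι * c)) * ‖oracleUnitary w G₀ ψ‖ ^ 2),
      ∑ j, (B.acceptWeight (F j) Q (oracleUnitary w (G j) ψ) -
        B.acceptWeight E Q (oracleUnitary w G₀ ψ)) ≤
        (B.primitiveQueries + 1 : ℕ) * (2 * √(Fintype.card ι * c)) * ‖ψ‖ ^ 2 := by
    intro B G G₀ hG ψ hB
    rw [LinearIsometryEquiv.norm_map] at hB
    have h₁ : ∑ j, (B.acceptWeight (F j) Q (oracleUnitary w (G j) ψ) -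
        B.acceptWeight (F j) Q (oracleUnitary w G₀ ψ)) ≤
        2 * √(Fintype.card ι * c) * ‖ψ‖ * ‖ψ‖ := by
      refine (sum_le_sum fun j _ => B.acceptWeight_sub_le_of_norm_eq (F j) Q
        (LinearIsometryEquiv.norm_map _ ψ) (LinearIsometryEquiv.norm_map _ ψ)).trans ?_
      rw [← sum_mul]
      exact mul_le_mul_of_nonneg_right (sum_norm_oracleUnitary_sub_le G G₀ c hG ψ)
        (norm_nonneg ψ)
    have h₂ := add_le_add h₁ hB
    rw [← sum_add_distrib] at h₂
    simp only [sub_add_sub_cancel] at h₂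
    refine h₂.trans_eq ?_
    push_cast
    ring
  induction A generalizing ψ with
  | halt b => simp [acceptWeight, primitiveQueries]
  | applyUnitary U A ih =>
    have h := ih (U ψ)
    rw [LinearIsometryEquiv.norm_map] at h
    exact h
  | measureFn f A ih =>
    simp only [acceptWeight, ← sum_sub_distrib]
    rw [sum_comm, ← sum_norm_collapse_sq f, mul_sum]
    refine sum_le_sum fun o _ => (ih o _).trans ?_
    gcongr
    exact le_sup (f := fun o => (A o).primitiveQueries) (mem_univ o)
  | queryE A ih =>
    exact hstep A (fun j κ x => F j κ x) (fun κ x => E κ x) hc ψ (ih _)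
  | queryEInv A ih =>
    exact hstep A (fun j κ y => (F j κ).symm y) (fun κ y => (E κ).symm y) hc' ψ (ih _)
  | queryEv x A ih =>
    refine (ih (Q x) ψ).trans ?_
    gcongr
    exact le_sup (f := fun y => (A y).primitiveQueries) (mem_univ _)
  | queryInv y A ih =>
    refine (ih (Q.symm y) ψ).trans ?_
    gcongr
    exact le_sup (f := fun y => (A y).primitiveQueries) (mem_univ _)

end Adversary

/-! ### The advantage against FX -/

/-- The real game, on the probability space of the ideal one. -/
theorem sum_acceptProb_FX {k n w : ℕ} (A : Adversary k n w) (M Y : List (Bits n))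
    (hA : A.OnlyQueries {x | x ∈ M} {y | y ∈ Y}) :
    ∑ E : IdealCipher k n, ∑ K : Bits (k + n), ∑ _P : Equiv.Perm (Bits n),
        A.acceptProb E (FX k n E K) =
      ∑ E : IdealCipher k n, ∑ P : Equiv.Perm (Bits n), ∑ K : Bits (k + n),
        A.acceptProb (reprogram M Y P E K) P := by
  have h : ∀ K : Bits (k + n),
      ∑ E : IdealCipher k n, ∑ P : Equiv.Perm (Bits n), A.acceptProb (reprogram M Y P E K) P =
      ∑ E : IdealCipher k n, ∑ _P : Equiv.Perm (Bits n), A.acceptProb E (FX k n E K) := by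
    intro K
    have h₁ := sum_sum_reprogram M Y K fun E => A.acceptProb E (FX k n E K)
    simp only [sum_const, card_univ, nsmul_eq_mul, ← mul_sum]
    rw [← h₁]
    refine sum_congr rfl fun E _ => sum_congr rfl fun P _ => ?_
    exact (A.acceptWeight_congr hA _ (fun x hx => FX_reprogram_apply Y P E K hx)
      (fun y hy => FX_reprogram_symm_apply M P E K hy) _).symm
  rw [sum_comm]
  simp_rw [← h]
  rw [sum_comm]
  exact sum_congr rfl fun E _ => sum_comm

theorem mainTheorem1 (k n w p q : ℕ) (A : Adversary k n w)
    (hp : A.primitiveQueries ≤ p) (hq : A.NonAdaptive q) :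
    sprpAdvantage (FX k n) A ≤ Real.sqrt (8 * (p : ℝ) ^ 2 * (q : ℝ) / 2 ^ (k + n)) := by
  obtain ⟨q₁, q₂, M, Y, hqq, hA⟩ := hq
  have hM : Set.range M = {x | x ∈ List.ofFn M} := by ext; simp [List.mem_ofFn]
  have hY : Set.range Y = {y | y ∈ List.ofFn Y} := by ext; simp [List.mem_ofFn]
  rw [hM, hY] at hA
  have hlen : 2 * ((List.ofFn M).length + (List.ofFn Y).length) ≤ 2 * q := by
    simpa using hqq
  have hcard : (Fintype.card (Bits (k + n)) : ℝ) = 2 ^ (k + n) := by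
    simp [ZMod.card]
  have hbound : ∀ (E : IdealCipher k n) (P : Equiv.Perm (Bits n)),
      ∑ K : Bits (k + n), (A.acceptProb (reprogram (List.ofFn M) (List.ofFn Y) P E K) P -
        A.acceptProb E P) ≤ p * (2 * √(2 ^ (k + n) * (2 * q))) := by
    intro E P
    have h := A.sum_acceptWeight_sub_le (reprogram (List.ofFn M) (List.ofFn Y) P E) E P (2 * q)
      (fun κ x => (card_reprogram_ne_le _ _ P E κ x).trans hlen)
      (fun κ y => (card_reprogram_symm_ne_le _ _ P E κ y).trans hlen)
      (EuclideanSpace.single 0 1)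
    rw [hcard] at h
    refine h.trans ?_
    have h1 : ‖(EuclideanSpace.single 0 1 : QState k n w)‖ = 1 := by simp
    rw [h1, one_pow, mul_one]
    push_cast
    gcongr
  have hnum : (∑ E : IdealCipher k n, ∑ K : Bits (k + n), ∑ _P : Equiv.Perm (Bits n),
        A.acceptProb E (FX k n E K)) -
      ∑ E : IdealCipher k n, ∑ _K : Bits (k + n), ∑ P : Equiv.Perm (Bits n),
        A.acceptProb E P ≤
      Fintype.card (IdealCipher k n) * (Fintype.card (Equiv.Perm (Bits n)) *
        (p * (2 * √(2 ^ (k + n) * (2 * q))))) := by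
    rw [sum_acceptProb_FX A _ _ hA, ← sum_sub_distrib]
    refine (sum_le_sum fun E _ => (?_ : _ ≤ (Fintype.card (Equiv.Perm (Bits n)) *
      (p * (2 * √(2 ^ (k + n) * (2 * q)))) : ℝ))).trans_eq (by simp)
    rw [sum_comm (s := (univ : Finset (Bits (k + n)))), ← sum_sub_distrib]
    refine (sum_le_sum fun P _ => (?_ : _ ≤ (p * (2 * √(2 ^ (k + n) * (2 * q))) : ℝ))).trans_eq
      (by simp)
    rw [← sum_sub_distrib]
    exact hbound E P
  have hE : (0 : ℝ) < Fintype.card (IdealCipher k n) := by exact_mod_cast Fintype.card_pos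
  have hP : (0 : ℝ) < Fintype.card (Equiv.Perm (Bits n)) := by exact_mod_cast Fintype.card_pos
  have h2 : (0 : ℝ) < 2 ^ (k + n) := by positivity
  rw [sprpAdvantage, sprpGame, sprpGame, ← sub_div, hcard, div_le_iff₀ (by positivity)]
  simp only [if_true, Bool.false_eq_true, if_false]
  refine hnum.trans_eq ?_
  have hsqrt : p * (2 * √(2 ^ (k + n) * (2 * q))) =
      √(8 * (p : ℝ) ^ 2 * q / 2 ^ (k + n)) * 2 ^ (k + n) := by
    rw [← Real.sqrt_sq (by positivity : 0 ≤ p * (2 * √(2 ^ (k + n) * (2 * (q : ℝ))))),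
      ← Real.sqrt_sq h2.le, ← Real.sqrt_mul (by positivity), Real.sqrt_sq h2.le, mul_pow, mul_pow,
      Real.sq_sqrt (by positivity)]
    congr 1
    field_simp
    ring
  rw [hsqrt]
  ring
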